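/- Let $X$ be a random variable with values in an arbitrary measurable space $\mathcal X$ and let $Y=f(X)$ almost surely, where $f:\mathcal X\to\mathcal Y$ is measurable and $\mathcal Y$ is a countable set of labels containing a distinguished label $0$ (with all subsets measurable; $0$ need not have positive probability). Let $I(\cdot\,;\cdot)\in[0,\infty]$ be mutual information and $H(Y)\in[0,\infty]$ Shannon entropy. A bottleneck variable is a random variable $T$, with an arbitrary measurable outcome space and jointly distributed with $(X,Y)$ (on a possibly enlarged probability space, keeping the law of $(X,Y)$), such that the Markov condition $Y-X-T$ holds, i.e. $Y$ and $T$ are conditionally independent given $X$. The information bottleneck (IB) curve is $$F(r)=\max\{\,I(Y;T)\;:\;T\text{ a bottleneck variable with } I(X;T)\le r\,\},\qquad r\in[0,\infty].$$ For $\alpha\in[0,1]$ let $B_\alpha$ be a $\{0,1\}$-valued random variable, independent of $(X,Y)$, that equals $1$ with probability $\alpha$, and let $T_\alpha=B_\alpha\cdot Y=B_\alpha\cdot f(X)$, i.e. $T_\alpha=Y$ if $B_\alpha=1$ and $T_\alpha=0$ if $B_\alpha=0$. Then: 1. For every $r\in[0,\infty]$ the maximum defining $F(r)$ is attained and $F(r)=\min\{r,H(Y)\}$.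 Thus $F(r)=r$ (the bound $I(Y;T)\le I(X;T)$ of the data processing inequality is saturated) for $r\le H(Y)$, and $F(r)=H(Y)$ is flat for $r\ge H(Y)$. 2. As a real function on $[0,\infty)$, $F$ is continuous and piecewise linear with finitely many break points, and it is not strictly concave. 3. Every $T_\alpha$ is a bottleneck variable with $I(Y;T_\alpha)=I(X;T_\alpha)$; moreover $I(X;T_0)=0$ and $I(X;T_1)=H(Y)$. If $H(Y)<\infty$ (in particular if $\mathcal Y$ is finite), then $$\{(I(X;T_\alpha),I(Y;T_\alpha)):\alpha\in[0,1]\}=\{(s,s):0\le s\le H(Y)\},$$ so the family $(T_\alpha)$ attains the data processing bound at every value of $I(X;T)\in[0,H(Y)]$. -/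

import Mathlib

open MeasureTheory ProbabilityTheory Set
open scoped ENNReal

universe t u v w

noncomputable section

namespace InfoBottleneck

variable {Ω α β γ : Type*} [MeasurableSpace α] [MeasurableSpace β] [MeasurableSpace γ]

/-- Mutual information `I(U;V)` in nats of two random variables on `(Ω, Q)`: the Kullback-Leibler
divergence of their joint law from the product of their laws. It may be `∞`. -/
def mutualInfo [MeasurableSpace Ω] (Q : Measure Ω) (U : Ω → α) (V : Ω → β) : ℝ≥0∞ :=
  InformationTheory.klDiv (Q.map fun ω => (U ω, V ω)) ((Q.map U).prod (Q.map V))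

/-- Shannon entropy `H(U) = ∑ a, - p(a) log p(a)` in nats of a discrete random variable.
It may be `∞` when `U` has infinitely many outcomes. -/
def entropy [MeasurableSpace Ω] (Q : Measure Ω) (U : Ω → α) : ℝ≥0∞ :=
  ∑' a, ENNReal.ofReal (Real.negMulLog ((Q.map U).real {a}))

/-- The Markov condition `U - V - W`: `U` and `W` are conditionally independent given `V`, i.e.
`P(U ∈ A, W ∈ B | V) = P(U ∈ A | V) P(W ∈ B | V)` almost surely for all measurable `A`, `B`.
(Written out because Mathlib's `CondIndepFun` is restricted to standard Borel sample spaces.) -/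
def IsMarkovChain [MeasurableSpace Ω] (Q : Measure Ω) (U : Ω → α) (V : Ω → β) (W : Ω → γ) :
    Prop :=
  ∀ (A : Set α) (B : Set γ), MeasurableSet A → MeasurableSet B →
    Q⟦U ⁻¹' A ∩ W ⁻¹' B | MeasurableSpace.comap V inferInstance⟧ =ᵐ[Q]
      fun ω => (Q⟦U ⁻¹' A | MeasurableSpace.comap V inferInstance⟧) ω *
        (Q⟦W ⁻¹' B | MeasurableSpace.comap V inferInstance⟧) ω

section Bottleneck

variable {𝒳 : Type u} {𝒴 : Type v} {𝒯 : Type w}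
  [MeasurableSpace 𝒳] [MeasurableSpace 𝒴] [MeasurableSpace 𝒯]

/-- A bottleneck variable `T` with outcomes in `𝒯` for the joint law `p` of `(X, Y)`, given through
the joint law `ρ` of `(X, Y, T)`: the pair `(X, Y)` has law `p` and `Y - X - T` holds. -/
structure IsBottleneck (p : Measure (𝒳 × 𝒴)) (ρ : Measure (𝒳 × 𝒴 × 𝒯)) : Prop where
  law_eq : ρ.map (fun z => (z.1, z.2.1)) = p
  markov : IsMarkovChain ρ (fun z => z.2.1) (fun z => z.1) (fun z => z.2.2)

/-- The compression term `I(X;T)` when `(X, Y, T)` has law `ρ`. -/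
def infoXT (ρ : Measure (𝒳 × 𝒴 × 𝒯)) : ℝ≥0∞ :=
  mutualInfo ρ (fun z => z.1) (fun z => z.2.2)

/-- The prediction term `I(Y;T)` when `(X, Y, T)` has law `ρ`. -/
def infoYT (ρ : Measure (𝒳 × 𝒴 × 𝒯)) : ℝ≥0∞ :=
  mutualInfo ρ (fun z => z.2.1) (fun z => z.2.2)

/-- The values `I(Y;T)` over all bottleneck variables `T`, with an arbitrary outcome space,
that satisfy `I(X;T) ≤ r`. -/
def feasibleValues (p : Measure (𝒳 × 𝒴)) (r : ℝ≥0∞) : Set ℝ≥0∞ :=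
  {i | ∃ (𝒯 : Type w) (_ : MeasurableSpace 𝒯) (ρ : Measure (𝒳 × 𝒴 × 𝒯)),
    IsBottleneck p ρ ∧ infoXT ρ ≤ r ∧ i = infoYT ρ}

/-- The information bottleneck curve `F(r) = sup {I(Y;T) : Y - X - T, I(X;T) ≤ r}`. -/
def ibCurve (p : Measure (𝒳 × 𝒴)) (r : ℝ≥0∞) : ℝ≥0∞ :=
  sSup (feasibleValues.{u, v, w} p r)

/-- The IB curve as a real function of a real argument (meant for `r ≥ 0`). -/
def ibCurveReal (p : Measure (𝒳 × 𝒴)) (r : ℝ) : ℝ :=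
  (ibCurve.{u, v, w} p (ENNReal.ofReal r)).toReal

/-- The joint law of `(X, Y, B · Y)`, where `(X, Y)` has law `p` and `B` is a Bernoulli variable,
independent of `(X, Y)`, with `B = 1` with probability `a`. The value `1` of `B` is encoded as
`true` and `0` as `false`, so that `B · Y` is `Y` if `B = 1` and `0` if `B = 0`. -/
def bernoulliBottleneck [Zero 𝒴] (p : Measure (𝒳 × 𝒴)) (a : unitInterval) :
    Measure (𝒳 × 𝒴 × 𝒴) :=
  (p.prod (bernoulliMeasure true false a)).map
    fun z => (z.1.1, z.1.2, if z.2 then z.1.2 else 0)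

end Bottleneck

/-- `g` is continuous and piecewise linear (affine) on `s`, with finitely many break points. -/
def IsPiecewiseLinearOn (g : ℝ → ℝ) (s : Set ℝ) : Prop :=
  ContinuousOn g s ∧ ∃ D : Finset ℝ, ∀ a b : ℝ, Icc a b ⊆ s → Disjoint (Ioo a b) (D : Set ℝ) →
    ∃ m c : ℝ, ∀ x ∈ Icc a b, g x = m * x + c

end InfoBottleneck

end

/-! Since `Y` is a function of `X`, data processing gives `I(Y;T) ≤ I(X;T)`, and for discrete `Y`
also `I(Y;T) ≤ I(Y;Y) = H(Y)`; hence `min r H(Y)` is an upper bound.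

For attainment, take `T = B · g(Y)` with `B` an independent Bernoulli variable. Given `g(Y)`, the
variable `T` depends on `B` alone, so it is independent of `X`, and the chain `I(g(Y);T) ≤ I(Y;T) ≤
I(X;T) ≤ I(g(Y);T)` closes (`infoXT_gatedLaw`). The last inequality is
`mutualInfo_le_of_condIndep_discrete`, an instance of the contraction of Kullback-Leibler divergence
under Markov kernels.

If `H(g(Y)) < ∞`, the common value is an explicit continuous function of the Bernoulli parameter
(`toReal_mutualInfo_gate`), running from `0` to `H(g(Y))`, so every value in between occurs. When
`H(Y)` may be infinite, a value `s < H(Y)` is reached by first lumping all but finitely many labels,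
which leaves a finite entropy above `s` (`exists_finite_entropy_gt`); the value `H(Y)` itself comes
from an injective relabelling of `Y`. -/

namespace InfoBottleneck

/-! ### Data processing inequalities for mutual information -/

section MutualInfo

variable {Ω Ω' α β γ δ : Type*} [MeasurableSpace Ω] [MeasurableSpace Ω'] [MeasurableSpace α]
  [MeasurableSpace β] [MeasurableSpace γ] [MeasurableSpace δ]

lemma mutualInfo_map {Q : Measure Ω} {g : Ω → Ω'} {U : Ω' → α} {V : Ω' → β}
    (hg : Measurable g) (hU : Measurable U) (hV : Measurable V) :
    mutualInfo (Q.map g) U V = mutualInfo Q (U ∘ g) (V ∘ g) := by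
  simp only [mutualInfo]
  rw [Measure.map_map (by fun_prop) hg, Measure.map_map hU hg, Measure.map_map hV hg]
  rfl

lemma mutualInfo_congr {Q : Measure Ω} {U U' : Ω → α} {V V' : Ω → β}
    (hU : U =ᵐ[Q] U') (hV : V =ᵐ[Q] V') : mutualInfo Q U V = mutualInfo Q U' V' := by
  have h : (fun ω => (U ω, V ω)) =ᵐ[Q] fun ω => (U' ω, V' ω) := by
    filter_upwards [hU, hV] with ω h1 h2
    rw [h1, h2]
  simp only [mutualInfo]
  rw [Measure.map_congr h, Measure.map_congr hU, Measure.map_congr hV]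

variable {Q : Measure Ω} [IsProbabilityMeasure Q] {U : Ω → α} {V : Ω → β} {W : Ω → γ}

/-- The data processing inequality for a function of the first variable. -/
lemma mutualInfo_comp_left_le (hU : Measurable U) (hV : Measurable V) {φ : α → δ}
    (hφ : Measurable φ) : mutualInfo Q (φ ∘ U) V ≤ mutualInfo Q U V := by
  have := Measure.isProbabilityMeasure_map (μ := Q) hU.aemeasurable
  have := Measure.isProbabilityMeasure_map (μ := Q) hV.aemeasurable
  have := Measure.isProbabilityMeasure_map (μ := Q) (hU.prodMk hV).aemeasurable
  have h := InformationTheory.klDiv_map_le (Q.map fun ω => (U ω, V ω)) ((Q.map U).prod (Q.map V))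
    (hφ.prodMap (measurable_id (α := β)))
  rw [Measure.map_map (by fun_prop) (by fun_prop), ← Measure.map_prod_map _ _ hφ measurable_id,
    Measure.map_id, Measure.map_map hφ hU] at h
  exact h

lemma mutualInfo_comm_le (hU : Measurable U) (hV : Measurable V) :
    mutualInfo Q V U ≤ mutualInfo Q U V := by
  have := Measure.isProbabilityMeasure_map (μ := Q) hU.aemeasurable
  have := Measure.isProbabilityMeasure_map (μ := Q) hV.aemeasurable
  have := Measure.isProbabilityMeasure_map (μ := Q) (hU.prodMk hV).aemeasurable
  have h := InformationTheory.klDiv_map_le (Q.map fun ω => (U ω, V ω)) ((Q.map U).prod (Q.map V))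
    measurable_swap
  rw [Measure.map_map (by fun_prop) (by fun_prop), Measure.prod_swap] at h
  exact h

lemma mutualInfo_comm (hU : Measurable U) (hV : Measurable V) :
    mutualInfo Q V U = mutualInfo Q U V :=
  le_antisymm (mutualInfo_comm_le hU hV) (mutualInfo_comm_le hV hU)

lemma mutualInfo_const_right (hU : Measurable U) (c : β) : mutualInfo Q U (fun _ => c) = 0 := by
  have := Measure.isProbabilityMeasure_map (μ := Q) hU.aemeasurable
  have h : (Q.map fun ω => (U ω, c)) = (Q.map U).map fun u => (u, c) := by
    rw [Measure.map_map (by fun_prop) hU]; rfl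
  rw [mutualInfo, h, Measure.map_const, measure_univ, one_smul, Measure.prod_dirac]
  exact InformationTheory.klDiv_self _

/-- If `V` is discrete and `U`, `W` are conditionally independent given `V`, then
`I(U;W) ≤ I(V;W)`. -/
lemma mutualInfo_le_of_condIndep_discrete [Countable β] [MeasurableSingletonClass β]
    (hU : Measurable U) (hV : Measurable V) (hW : Measurable W)
    (h : ∀ (v : β) (A : Set α) (C : Set γ), MeasurableSet A → MeasurableSet C →
      Q (V ⁻¹' {v} ∩ (U ⁻¹' A ∩ W ⁻¹' C)) * Q (V ⁻¹' {v}) =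
        Q (V ⁻¹' {v} ∩ U ⁻¹' A) * Q (V ⁻¹' {v} ∩ W ⁻¹' C)) :
    mutualInfo Q U W ≤ mutualInfo Q V W := by
  classical
  have := Measure.isProbabilityMeasure_map (μ := Q) hU.aemeasurable
  have := Measure.isProbabilityMeasure_map (μ := Q) hV.aemeasurable
  have := Measure.isProbabilityMeasure_map (μ := Q) hW.aemeasurable
  have := Measure.isProbabilityMeasure_map (μ := Q) (hV.prodMk hW).aemeasurable
  -- The conditional law of `U` given `V = v`. On null atoms the value is immaterial; the law of `U`
  -- is chosen so that `κ` is Markov.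
  let κ : Kernel β α :=
    ⟨fun v => if Q (V ⁻¹' {v}) = 0 then Q.map U else (Q[|V ⁻¹' {v}]).map U, .of_discrete⟩
  have hκ_apply (v : β) :
      κ v = if Q (V ⁻¹' {v}) = 0 then Q.map U else (Q[|V ⁻¹' {v}]).map U := rfl
  have : IsMarkovKernel κ := by
    refine ⟨fun v => ?_⟩
    rw [hκ_apply]
    split_ifs with h0
    · infer_instance
    · have := cond_isProbabilityMeasure (μ := Q) h0
      exact Measure.isProbabilityMeasure_map hU.aemeasurable
  have hκ (v : β) {A : Set α} {C : Set γ} (hA : MeasurableSet A) (hC : MeasurableSet C) :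
      κ v A * Q (V ⁻¹' {v} ∩ W ⁻¹' C) = Q (V ⁻¹' {v} ∩ (U ⁻¹' A ∩ W ⁻¹' C)) := by
    rw [hκ_apply]
    split_ifs with h0
    · rw [measure_mono_null inter_subset_left h0, measure_mono_null inter_subset_left h0, mul_zero]
    · rw [Measure.map_apply hU hA, cond_apply (hV (measurableSet_singleton v)), mul_assoc,
        ← h v A C hA hC, mul_comm, mul_assoc, ENNReal.mul_inv_cancel h0 (measure_ne_top _ _),
        mul_one]
  have hsum (S : Set Ω) (hS : MeasurableSet S) : Q S = ∑' v, Q (V ⁻¹' {v} ∩ S) := by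
    rw [← measure_iUnion]
    · congr 1; ext ω; simp
    · exact fun v v' hv => Disjoint.inter_left _ (Disjoint.inter_right _
        (Disjoint.preimage _ (by simpa using hv)))
    · exact fun v => (hV (measurableSet_singleton v)).inter hS
  have hmain {A : Set α} {C : Set γ} (hA : MeasurableSet A) (hC : MeasurableSet C) :
      Q (U ⁻¹' A ∩ W ⁻¹' C) = ∫⁻ ω in W ⁻¹' C, κ (V ω) A ∂Q := by
    rw [← lintegral_map (f := fun v => κ v A) .of_discrete hV, lintegral_countable',
      hsum _ ((hU hA).inter (hW hC))]
    refine tsum_congr fun v => ?_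
    rw [Measure.map_apply hV (measurableSet_singleton v),
      Measure.restrict_apply (hV (measurableSet_singleton v)), hκ v hA hC]
  -- The kernel resamples `U` from `V` and keeps `W`. By conditional independence it carries the
  -- joint law of `(V, W)` to that of `(U, W)`; it also carries product of marginals to product of
  -- marginals, so divergence can only drop.
  have hjoint : (κ ∥ₖ (Kernel.id (α := γ))) ∘ₘ (Q.map fun ω => (V ω, W ω)) =
      Q.map fun ω => (U ω, W ω) := by
    refine Measure.ext_prod fun {A C} hA hC => ?_
    rw [Measure.bind_apply (hA.prod hC) (Kernel.aemeasurable _),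
      Measure.map_apply (by fun_prop) (hA.prod hC), lintegral_map
        (Kernel.measurable_coe _ (hA.prod hC)) (by fun_prop)]
    simp_rw [Kernel.parallelComp_apply_prod, Kernel.id_apply, Measure.dirac_apply' _ hC]
    change _ = Q (U ⁻¹' A ∩ W ⁻¹' C)
    rw [hmain hA hC, ← lintegral_indicator (hW hC)]
    refine lintegral_congr fun ω => ?_
    by_cases hω : W ω ∈ C <;> simp [indicator, hω]
  have hmarg : κ ∘ₘ (Q.map V) = Q.map U := by
    ext A hA
    rw [Measure.bind_apply hA (Kernel.aemeasurable _), Measure.map_apply hU hA,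
      lintegral_map (Kernel.measurable_coe _ hA) hV]
    have := hmain hA MeasurableSet.univ
    simpa using this.symm
  have hprod : (κ ∥ₖ (Kernel.id (α := γ))) ∘ₘ ((Q.map V).prod (Q.map W)) =
      (Q.map U).prod (Q.map W) := by
    refine Measure.ext_prod fun {A C} hA hC => ?_
    rw [Measure.bind_apply (hA.prod hC) (Kernel.aemeasurable _), Measure.prod_prod, ← hmarg,
      Measure.bind_apply hA (Kernel.aemeasurable _)]
    simp_rw [Kernel.parallelComp_apply_prod, Kernel.id_apply]
    rw [lintegral_prod_mul (f := fun v => κ v A) (g := fun w => Measure.dirac w C)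
      (Kernel.measurable_coe _ hA).aemeasurable
      ((Measure.measurable_coe hC).comp Measure.measurable_dirac).aemeasurable]
    congr 1
    simp_rw [Measure.dirac_apply' _ hC]
    rw [lintegral_indicator hC]; simp
  have key := InformationTheory.klDiv_comp_right_le (Q.map fun ω => (V ω, W ω))
    ((Q.map V).prod (Q.map W)) (κ ∥ₖ (Kernel.id (α := γ)))
  rw [hjoint, hprod] at key
  exact key

/-- `I(V;W) ≤ I(V;V)` for a discrete random variable `V`. -/
lemma mutualInfo_le_self [Countable β] [MeasurableSingletonClass β]
    (hV : Measurable V) (hW : Measurable W) : mutualInfo Q V W ≤ mutualInfo Q V V := by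
  rw [mutualInfo_comm hW hV]
  -- Given `V`, a copy of `V` is constant and so independent of `W`: the event `V = v` lies inside
  -- `V ⁻¹' C` or is disjoint from it.
  refine mutualInfo_le_of_condIndep_discrete hW hV hV fun v A C hA hC => ?_
  by_cases hv : v ∈ C
  · have h1 : V ⁻¹' {v} ∩ V ⁻¹' C = V ⁻¹' {v} := by
      rw [inter_eq_left]; rintro ω rfl; exact hv
    rw [h1, inter_comm (W ⁻¹' A), ← inter_assoc, h1]
  · have h1 : V ⁻¹' {v} ∩ V ⁻¹' C = ∅ := by
      ext ω; simp only [mem_inter_iff, mem_preimage, mem_singleton_iff, mem_empty_iff_false,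
        iff_false]
      rintro ⟨rfl, h⟩; exact hv h
    rw [inter_comm (W ⁻¹' A), ← inter_assoc, h1]; simp

end MutualInfo

end InfoBottleneck

namespace InfoBottleneck

/-! ### Divergence and entropy on countable spaces -/

section Discrete

variable {α : Type*} [MeasurableSpace α] [Countable α]

lemma ae_measure_singleton_ne_zero (μ : Measure α) : ∀ᵐ x ∂μ, μ {x} ≠ 0 := by
  rw [ae_iff_of_countable]
  exact fun x hx => hx

variable [MeasurableSingletonClass α]

/-- Integrating the density over `{x}` gives `μ.rnDeriv ν x * ν {x} = μ {x}`, and `ν {x}` can be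
cancelled at every atom of `μ`. -/
lemma llr_ae_eq_log_div {μ ν : Measure α} [IsFiniteMeasure μ] [IsFiniteMeasure ν] (h : μ ≪ ν) :
    llr μ ν =ᵐ[μ] fun x => Real.log (μ.real {x} / ν.real {x}) := by
  filter_upwards [ae_measure_singleton_ne_zero μ] with x hx
  have hν : ν {x} ≠ 0 := fun h0 => hx (h h0)
  have h1 : μ.rnDeriv ν x * ν {x} = μ {x} := by
    rw [← Measure.setLIntegral_rnDeriv h {x}, lintegral_singleton]
  rw [llr, measureReal_def, measureReal_def, ← ENNReal.toReal_div, ← h1,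
    ENNReal.mul_div_cancel_right hν (measure_ne_top _ _)]

/-- A nonnegative log-likelihood ratio fails to be integrable exactly when its lower integral is
`∞`, so the formula also covers infinite divergence. This lets `I(V;V) = H(V)` hold without assuming
finite entropy. -/
lemma klDiv_eq_lintegral_llr {β : Type*} [MeasurableSpace β] {μ ν : Measure β}
    [IsProbabilityMeasure μ] [IsProbabilityMeasure ν]
    (h : μ ≪ ν) (h0 : 0 ≤ᵐ[μ] llr μ ν) :
    InformationTheory.klDiv μ ν = ∫⁻ x, ENNReal.ofReal (llr μ ν x) ∂μ := by
  by_cases hi : Integrable (llr μ ν) μ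
  · rw [InformationTheory.klDiv_of_ac_of_integrable h hi, ← ofReal_integral_eq_lintegral_ofReal hi h0]
    simp
  · rw [InformationTheory.klDiv_of_not_integrable hi]
    by_contra hne
    exact hi ((lintegral_ofReal_ne_top_iff_integrable
      (measurable_llr _ _).aestronglyMeasurable h0).1 (Ne.symm hne))

lemma absolutelyContinuous_prod_of_countable {Ω β : Type*} [MeasurableSpace Ω]
    [MeasurableSpace β] [Countable β] [MeasurableSingletonClass β]
    {Q : Measure Ω} [IsFiniteMeasure Q] {U : Ω → α} {V : Ω → β}
    (hU : Measurable U) (hV : Measurable V) :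
    (Q.map fun ω => (U ω, V ω)) ≪ (Q.map U).prod (Q.map V) := by
  intro s hs
  rw [Measure.map_apply (by fun_prop) .of_discrete, ← biUnion_of_singleton s, preimage_iUnion₂,
    measure_biUnion_null_iff s.to_countable]
  rintro ⟨a, b⟩ hab
  have h1 := measure_mono_null (singleton_subset_iff.2 hab) hs
  rw [← singleton_prod_singleton, Measure.prod_prod, mul_eq_zero,
    Measure.map_apply hU (measurableSet_singleton _),
    Measure.map_apply hV (measurableSet_singleton _)] at h1
  rcases h1 with h1 | h1
  · exact measure_mono_null (fun ω hω => congrArg Prod.fst hω) h1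
  · exact measure_mono_null (fun ω hω => congrArg Prod.snd hω) h1

/-- `I(V;V) = H(V)` for a discrete random variable. -/
lemma mutualInfo_self {Ω : Type*} [MeasurableSpace Ω] {Q : Measure Ω} [IsProbabilityMeasure Q]
    {V : Ω → α} (hV : Measurable V) : mutualInfo Q V V = entropy Q V := by
  have := Measure.isProbabilityMeasure_map (μ := Q) hV.aemeasurable
  have hJp := Measure.isProbabilityMeasure_map (μ := Q) (hV.prodMk hV).aemeasurable
  have hac := absolutelyContinuous_prod_of_countable (Q := Q) hV hV
  set q := Q.map V with hq
  have hJ : (Q.map fun ω => (V ω, V ω)) = q.map fun y => (y, y) := by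
    rw [hq, Measure.map_map (by fun_prop) hV]; rfl
  rw [mutualInfo]
  rw [hJ] at hac hJp ⊢
  -- On the diagonal the density is `q{y} / q{y}² = 1 / q{y}`, whose logarithm is nonnegative.
  have hll : (fun y => llr (q.map fun y => (y, y)) (q.prod q) (y, y)) =ᵐ[q]
      fun y => - Real.log (q.real {y}) := by
    filter_upwards [ae_of_ae_map (by fun_prop) (llr_ae_eq_log_div hac),
      ae_measure_singleton_ne_zero q] with y hy hy0
    have h1 : (q.map fun y => (y, y)).real {(y, y)} = q.real {y} := by
      rw [map_measureReal_apply (by fun_prop) (measurableSet_singleton _)]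
      congr 1; ext; simp
    have h2 : (q.prod q).real {(y, y)} = q.real {y} * q.real {y} := by
      rw [← singleton_prod_singleton, measureReal_prod_prod]
    have h3 : q.real {y} ≠ 0 := by simpa [measureReal_def, ENNReal.toReal_eq_zero_iff] using hy0
    rw [hy, h1, h2, ← Real.log_inv]
    congr 1
    field_simp
  rw [klDiv_eq_lintegral_llr hac, lintegral_map (by fun_prop) (by fun_prop),
    lintegral_congr_ae (hll.mono fun y hy => congrArg ENNReal.ofReal hy), lintegral_countable', entropy]
  · refine tsum_congr fun y => ?_
    rw [← hq, Real.negMulLog, neg_mul_comm, ENNReal.ofReal_mul measureReal_nonneg,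
      ofReal_measureReal, mul_comm]
  · refine (ae_map_iff (by fun_prop) .of_discrete).2 ?_
    filter_upwards [hll] with y hy
    rw [hy]
    simpa using Real.log_nonpos measureReal_nonneg measureReal_le_one

end Discrete

/-! ### The information carried by `B · Y` -/

section Bernoulli

variable {𝒴 : Type*} [MeasurableSpace 𝒴]

lemma map_fst_prod_bernoulliMeasure (q : Measure 𝒴) [IsProbabilityMeasure q] (a : unitInterval) :
    (q.prod (bernoulliMeasure true false a)).map Prod.fst = q := by
  rw [Measure.map_fst_prod, measure_univ, one_smul]

lemma summable_negMulLog {q : Measure 𝒴} [IsProbabilityMeasure q] (hH : entropy q id ≠ ∞) :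
    Summable fun y => Real.negMulLog (q.real {y}) := by
  rw [entropy, Measure.map_id] at hH
  refine (ENNReal.summable_toReal hH).congr fun y => ?_
  exact ENNReal.toReal_ofReal (Real.negMulLog_nonneg measureReal_nonneg measureReal_le_one)

lemma toReal_entropy {q : Measure 𝒴} [IsProbabilityMeasure q] :
    (entropy q id).toReal = ∑' y, Real.negMulLog (q.real {y}) := by
  rw [entropy, Measure.map_id, ENNReal.tsum_toReal_eq (fun _ => ENNReal.ofReal_ne_top)]
  exact tsum_congr fun y =>
    ENNReal.toReal_ofReal (Real.negMulLog_nonneg measureReal_nonneg measureReal_le_one)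

variable [Countable 𝒴] [MeasurableSingletonClass 𝒴]

lemma map_prod_bernoulliMeasure {β : Type*} [MeasurableSpace β] (q : Measure 𝒴)
    [IsProbabilityMeasure q] (a : unitInterval) {φ : 𝒴 × Bool → β} :
    (q.prod (bernoulliMeasure true false a)).map φ =
      ENNReal.ofReal a • q.map (fun y => φ (y, true)) +
        ENNReal.ofReal (1 - a) • q.map (fun y => φ (y, false)) := by
  have hφ : Measurable φ := .of_discrete
  have h1 : ((unitInterval.toNNReal a : NNReal) : ℝ≥0∞) = ENNReal.ofReal a := by
    rw [ENNReal.ofReal]; congr 1; ext; simp [a.2.1]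
  have h2 : ((unitInterval.toNNReal (unitInterval.symm a) : NNReal) : ℝ≥0∞)
      = ENNReal.ofReal (1 - a) := by
    rw [ENNReal.ofReal]; congr 1; ext; simp [a.2.2]
  ext s hs
  rw [Measure.map_apply hφ hs, Measure.prod_apply .of_discrete]
  simp only [bernoulliMeasure_def, Measure.add_apply, Measure.smul_apply, Measure.nnreal_smul_coe_apply]
  rw [lintegral_add_left .of_discrete, lintegral_const_mul _ .of_discrete,
    lintegral_const_mul _ .of_discrete, h1, h2, Measure.map_apply .of_discrete hs,
    Measure.map_apply .of_discrete hs, smul_eq_mul, smul_eq_mul]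
  congr 2
  · rw [← lintegral_indicator_one .of_discrete]
    refine lintegral_congr fun y => ?_
    rw [Measure.dirac_apply' _ .of_discrete]; rfl
  · rw [← lintegral_indicator_one .of_discrete]
    refine lintegral_congr fun y => ?_
    rw [Measure.dirac_apply' _ .of_discrete]; rfl

variable [Zero 𝒴]

/-- The variable `B · Y` as a function of `(Y, B)`. -/
def gate (z : 𝒴 × Bool) : 𝒴 := if z.2 then z.1 else 0

lemma measurable_gate : Measurable (gate (𝒴 := 𝒴)) := .of_discrete

lemma mutualInfo_gate_zero (q : Measure 𝒴) [IsProbabilityMeasure q] :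
    mutualInfo (q.prod (bernoulliMeasure true false 0)) Prod.fst gate = 0 := by
  have h : gate =ᵐ[q.prod (bernoulliMeasure true false 0)] fun _ => (0 : 𝒴) := by
    rw [bernoulliMeasure_zero, Measure.prod_dirac]
    refine (ae_map_iff (by fun_prop) .of_discrete).2 (.of_forall fun y => ?_)
    simp [gate]
  rw [mutualInfo_congr .rfl h, mutualInfo_const_right measurable_fst]

lemma mutualInfo_gate_one (q : Measure 𝒴) [IsProbabilityMeasure q] :
    mutualInfo (q.prod (bernoulliMeasure true false 1)) Prod.fst gate = entropy q id := by
  have h : gate =ᵐ[q.prod (bernoulliMeasure true false 1)] (Prod.fst : 𝒴 × Bool → 𝒴) := by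
    rw [bernoulliMeasure_one, Measure.prod_dirac]
    refine (ae_map_iff (by fun_prop) .of_discrete).2 (.of_forall fun y => ?_)
    simp [gate]
  rw [mutualInfo_congr .rfl h, mutualInfo_self measurable_fst, entropy, entropy,
    map_fst_prod_bernoulliMeasure, Measure.map_id]

lemma mutualInfo_gate_le (q : Measure 𝒴) [IsProbabilityMeasure q] (a : unitInterval) :
    mutualInfo (q.prod (bernoulliMeasure true false a)) Prod.fst gate ≤ entropy q id := by
  refine (mutualInfo_le_self measurable_fst measurable_gate).trans_eq ?_
  rw [mutualInfo_self measurable_fst, entropy, entropy, map_fst_prod_bernoulliMeasure,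
    Measure.map_id]

open Classical in
/-- The density of the joint law of `(Y, B · Y)` with respect to the product of its marginals. -/
lemma llr_gate_ae_eq (q : Measure 𝒴) [IsProbabilityMeasure q] (a : unitInterval)
    (ha0 : 0 < (a : ℝ)) (ha1 : (a : ℝ) < 1) (J M : Measure (𝒴 × 𝒴))
    (hJ : J = (q.prod (bernoulliMeasure true false a)).map fun z => (z.1, gate z))
    (hM : M = q.prod ((q.prod (bernoulliMeasure true false a)).map gate)) (hJM : J ≪ M) :
    (∀ᵐ y ∂q, llr J M (y, y) =
      if y = 0 then - Real.log (1 - a + a * q.real {0}) else - Real.log (q.real {y})) ∧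
    (∀ᵐ y ∂q, llr J M (y, 0) =
      if y = 0 then - Real.log (1 - a + a * q.real {0}) else
        Real.log (1 - a) - Real.log (1 - a + a * q.real {0})) := by
  have ha1' : 0 < 1 - (a : ℝ) := by linarith
  have hm : 0 < 1 - a + a * q.real {0} := by
    have := measureReal_nonneg (μ := q) (s := {0})
    positivity
  -- The joint law is a mixture of a diagonal part (`B = 1`) and a part on `t = 0` (`B = 0`). They
  -- overlap only at `(0, 0)`, where the masses add up to `q{0}`; hence the separate case `y = 0`.
  have hJs : J = ENNReal.ofReal a • q.map (fun y => (y, y)) +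
      ENNReal.ofReal (1 - a) • q.map (fun y => (y, 0)) := by
    rw [hJ, map_prod_bernoulliMeasure]; simp [gate]
  have hTs : (q.prod (bernoulliMeasure true false a)).map gate = ENNReal.ofReal a • q +
      ENNReal.ofReal (1 - a) • Measure.dirac 0 := by
    rw [map_prod_bernoulliMeasure]; simp [gate]
  have hsm (c : ℝ) {δ : Type _} [MeasurableSpace δ] (ν : Measure δ) [IsFiniteMeasure ν] (s : Set δ) :
      (ENNReal.ofReal c • ν) s ≠ ∞ :=
    ENNReal.mul_ne_top ENNReal.ofReal_ne_top (measure_ne_top _ _)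
  have hJr (y t : 𝒴) : J.real {(y, t)} =
      a * (if t = y then q.real {y} else 0) + (1 - a) * (if t = 0 then q.real {y} else 0) := by
    rw [hJs, measureReal_add_apply (hsm _ _ _) (hsm _ _ _), measureReal_ennreal_smul_apply,
      measureReal_ennreal_smul_apply,
      ENNReal.toReal_ofReal ha0.le, ENNReal.toReal_ofReal ha1'.le,
      map_measureReal_apply .of_discrete .of_discrete,
      map_measureReal_apply .of_discrete .of_discrete]
    congr 2
    · split_ifs with h
      · subst h; congr 1; ext; simp
      · convert measureReal_empty
        ext x; simp only [mem_preimage, mem_singleton_iff, Prod.mk.injEq, mem_empty_iff_false,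
          iff_false]
        rintro ⟨rfl, rfl⟩; exact h rfl
    · split_ifs with h
      · subst h; congr 1; ext; simp
      · convert measureReal_empty
        ext x; simp only [mem_preimage, mem_singleton_iff, Prod.mk.injEq, mem_empty_iff_false,
          iff_false]
        rintro ⟨rfl, rfl⟩; exact h rfl
  have hMr (y t : 𝒴) : M.real {(y, t)} =
      q.real {y} * (a * q.real {t} + (1 - a) * (if t = 0 then 1 else 0)) := by
    rw [hM, hTs, ← singleton_prod_singleton, measureReal_prod_prod,
      measureReal_add_apply (hsm _ _ _) (hsm _ _ _),
      measureReal_ennreal_smul_apply, measureReal_ennreal_smul_apply,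
      ENNReal.toReal_ofReal ha0.le, ENNReal.toReal_ofReal ha1'.le]
    congr 3
    rw [measureReal_def, Measure.dirac_apply]
    by_cases h : t = 0
    · simp [h]
    · simp [h, Ne.symm h]
  have hfin : IsFiniteMeasure J := by
    rw [hJ]; infer_instance
  have hfin' : IsFiniteMeasure M := by
    rw [hM]; infer_instance
  have hll := llr_ae_eq_log_div hJM
  have hll' := ae_add_measure_iff.1 (hll.filter_mono (ae_mono hJs.ge))
  have hc0 : ENNReal.ofReal a ≠ 0 := by simpa using ha0
  have hc1 : ENNReal.ofReal (1 - a) ≠ 0 := by simpa using ha1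
  -- As both weights are nonzero, a property holding `J`-almost everywhere holds almost everywhere
  -- on each part.
  rw [Measure.ae_ennreal_smul_measure_iff hc0, Measure.ae_ennreal_smul_measure_iff hc1] at hll'
  have hq (y : 𝒴) (hy : q {y} ≠ 0) : q.real {y} ≠ 0 := by
    simpa [measureReal_def, ENNReal.toReal_eq_zero_iff] using hy
  constructor
  · filter_upwards [ae_of_ae_map .of_discrete hll'.1, ae_measure_singleton_ne_zero q] with y hy hy0
    have := hq y hy0
    rw [hy, hJr, hMr, if_pos rfl]
    by_cases h : y = 0
    · subst h
      rw [if_pos rfl, if_pos rfl, if_pos rfl, ← Real.log_inv]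
      congr 1
      field_simp
      ring
    · rw [if_neg h, if_neg h, if_neg h, ← Real.log_inv]
      congr 1
      field_simp
  · filter_upwards [ae_of_ae_map .of_discrete hll'.2, ae_measure_singleton_ne_zero q] with y hy hy0
    have := hq y hy0
    rw [hy, hJr, hMr, if_pos rfl, if_pos rfl]
    by_cases h : y = 0
    · subst h
      rw [if_pos rfl, if_pos rfl, ← Real.log_inv]
      congr 1
      field_simp
      ring
    · rw [if_neg h, if_neg (Ne.symm h), ← Real.log_div ha1'.ne' hm.ne']
      congr 1
      field_simp
      ring

/-- The value `I(Y; B · Y) = H(B · Y) - H(B · Y | Y)` when `H(Y) < ∞`. -/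
lemma toReal_mutualInfo_gate (q : Measure 𝒴) [IsProbabilityMeasure q] (a : unitInterval)
    (hH : entropy q id ≠ ∞) :
    (mutualInfo (q.prod (bernoulliMeasure true false a)) Prod.fst gate).toReal =
      a * ((entropy q id).toReal - Real.negMulLog (q.real {0}))
        - (1 - q.real {0}) * Real.negMulLog (1 - a)
        + Real.negMulLog (1 - a + a * q.real {0}) := by
  classical
  -- The endpoints, where one part of the mixture vanishes, agree with the formula because
  -- `Real.negMulLog` is zero at `0` and `1`.
  rcases eq_or_ne a 0 with rfl | ha0
  · rw [mutualInfo_gate_zero]; simp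
  rcases eq_or_ne a 1 with rfl | ha1
  · rw [mutualInfo_gate_one]; simp
  replace ha0 : 0 < (a : ℝ) := unitInterval.pos_iff_ne_zero.2 ha0
  replace ha1 : (a : ℝ) < 1 := unitInterval.lt_one_iff_ne_one.2 ha1
  have ha1' : 0 < 1 - (a : ℝ) := by linarith
  set R := q.prod (bernoulliMeasure true false a) with hR
  have hac := absolutelyContinuous_prod_of_countable (Q := R) measurable_fst
    (measurable_gate (𝒴 := 𝒴))
  have hne := ((mutualInfo_gate_le q a).trans_lt hH.lt_top).ne
  rw [mutualInfo, map_fst_prod_bernoulliMeasure] at hne ⊢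
  rw [map_fst_prod_bernoulliMeasure] at hac
  -- Finite entropy bounds the divergence, hence gives the integrability needed to split the
  -- integral over the two parts.
  have hint := (InformationTheory.klDiv_ne_top_iff.1 hne).2
  have hprobJ : IsProbabilityMeasure (R.map fun z => (z.1, gate z)) :=
    Measure.isProbabilityMeasure_map (Measurable.of_discrete).aemeasurable
  have hprobT : IsProbabilityMeasure (R.map gate) :=
    Measure.isProbabilityMeasure_map measurable_gate.aemeasurable
  rw [InformationTheory.toReal_klDiv_of_measure_eq hac (by simp)]
  obtain ⟨hl1, hl0⟩ := llr_gate_ae_eq q a ha0 ha1 _ _ rfl rfl hac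
  have hJs : (R.map fun z => (z.1, gate z)) = ENNReal.ofReal a • q.map (fun y => (y, y)) +
      ENNReal.ofReal (1 - a) • q.map (fun y => (y, 0)) := by
    rw [hR, map_prod_bernoulliMeasure]; simp [gate]
  set J := R.map fun z => (z.1, gate z) with hJ
  set l := llr J (q.prod (R.map gate)) with hl
  have hlm : Measurable l := measurable_llr _ _
  rw [hJs, integrable_add_measure] at hint
  have hc0 : ENNReal.ofReal a ≠ 0 := by simpa using ha0
  have hc1 : ENNReal.ofReal (1 - a) ≠ 0 := by simpa using ha1
  rw [hJs, integral_add_measure hint.1 hint.2, integral_smul_measure, integral_smul_measure,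
    integral_map (by fun_prop) hlm.aestronglyMeasurable,
    integral_map (by fun_prop) hlm.aestronglyMeasurable,
    ENNReal.toReal_ofReal ha0.le, ENNReal.toReal_ofReal ha1'.le]
  rw [integrable_smul_measure hc0 ENNReal.ofReal_ne_top,
    integrable_smul_measure hc1 ENNReal.ofReal_ne_top,
    integrable_map_measure hlm.aestronglyMeasurable (by fun_prop),
    integrable_map_measure hlm.aestronglyMeasurable (by fun_prop)] at hint
  set m := 1 - a + a * q.real {0} with hm
  have hI1 : ∫ y, l (y, y) ∂q = (entropy q id).toReal - Real.negMulLog (q.real {0})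
      - q.real {0} * Real.log m := by
    rw [integral_congr_ae hl1, integral_countable (hint.1.congr hl1), toReal_entropy]
    -- The diagonal sum is the entropy sum except at `y = 0`, where `-log m` replaces `-log q{0}`;
    -- this one-term series is the correction.
    have hs : HasSum (fun y : 𝒴 => if y = 0 then
        - Real.negMulLog (q.real {0}) - q.real {0} * Real.log m else 0)
        (- Real.negMulLog (q.real {0}) - q.real {0} * Real.log m) := hasSum_ite_eq 0 _
    have := ((summable_negMulLog hH).hasSum.add hs).tsum_eq
    rw [add_sub, ← sub_eq_add_neg] at this
    rw [← this]
    refine tsum_congr fun y => ?_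
    by_cases h : y = 0
    · subst h; simp; ring
    · simp [h, Real.negMulLog]
  have hI0 : ∫ y, l (y, 0) ∂q = (1 - q.real {0}) * Real.log (1 - a) - Real.log m := by
    have h2 : (fun y => l (y, 0)) =ᵐ[q] fun y => (Real.log (1 - a) - Real.log m) -
        ({0} : Set 𝒴).indicator (fun _ => Real.log (1 - a)) y := by
      filter_upwards [hl0] with y hy
      rw [hy]
      by_cases h : y = 0 <;> simp [h, hm]
    rw [integral_congr_ae h2, integral_sub (integrable_const _)
      ((integrable_const _).indicator (measurableSet_singleton _)),
      integral_indicator_const _ (measurableSet_singleton _)]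
    simp
    ring
  rw [hI1, hI0]
  simp only [Real.negMulLog, smul_eq_mul]
  -- The coefficients of `-log m`, namely `a * q{0}` and `1 - a`, add up to `m`.
  linear_combination (-Real.log m) * hm

/-- If `H(Y) < ∞`, then `I(Y; B · Y)` takes every value in `[0, H(Y)]`. -/
lemma exists_mutualInfo_gate_eq (q : Measure 𝒴) [IsProbabilityMeasure q]
    (hH : entropy q id ≠ ∞) {s : ℝ≥0∞} (hs : s ≤ entropy q id) :
    ∃ a : unitInterval,
      mutualInfo (q.prod (bernoulliMeasure true false a)) Prod.fst gate = s := by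
  -- The closed formula is continuous up to the endpoints since `Real.negMulLog` is continuous at
  -- `0`.
  have hcont : Continuous fun a : unitInterval =>
      (mutualInfo (q.prod (bernoulliMeasure true false a)) Prod.fst gate).toReal := by
    simp_rw [toReal_mutualInfo_gate q _ hH]
    have := Real.continuous_negMulLog
    fun_prop
  have h0 : (mutualInfo (q.prod (bernoulliMeasure true false 0)) Prod.fst gate).toReal = 0 := by
    rw [mutualInfo_gate_zero]; rfl
  have h1 := congrArg ENNReal.toReal (mutualInfo_gate_one q)
  have hmem : s.toReal ∈ Icc (0 : ℝ) (entropy q id).toReal :=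
    ⟨ENNReal.toReal_nonneg, ENNReal.toReal_mono hH hs⟩
  have hivt := intermediate_value_univ (0 : unitInterval) 1 hcont
  rw [h0, h1] at hivt
  obtain ⟨a, ha⟩ := hivt hmem
  refine ⟨a, ?_⟩
  rwa [ENNReal.toReal_eq_toReal_iff' ((mutualInfo_gate_le q a).trans_lt hH.lt_top).ne
    (hs.trans_lt hH.lt_top).ne] at ha

end Bernoulli

end InfoBottleneck

namespace InfoBottleneck

/-! ### Bottleneck variables when `Y` is a function of `X` -/

section BottleneckVariables

variable {𝒳 : Type*} {𝒴 : Type*} {𝒯 : Type*}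
  [MeasurableSpace 𝒳] [MeasurableSpace 𝒴] [MeasurableSpace 𝒯]

lemma isProbabilityMeasure_of_map {Ω Ω' : Type*} [MeasurableSpace Ω] [MeasurableSpace Ω']
    {ρ : Measure Ω} {g : Ω → Ω'} (hg : Measurable g) [h : IsProbabilityMeasure (ρ.map g)] :
    IsProbabilityMeasure ρ :=
  ⟨by simpa [Measure.map_apply hg MeasurableSet.univ] using h.measure_univ⟩

lemma entropy_eq_entropy_id {Ω : Type*} [MeasurableSpace Ω] (Q : Measure Ω) (V : Ω → 𝒴) :
    entropy Q V = entropy (Q.map V) id := by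
  rw [entropy, entropy, Measure.map_id]

variable {p : Measure (𝒳 × 𝒴)} {ρ : Measure (𝒳 × 𝒴 × 𝒯)} {f : 𝒳 → 𝒴}

lemma ae_eq_of_law_eq (hf : ∀ᵐ z ∂p, z.2 = f z.1)
    (h : ρ.map (fun z => (z.1, z.2.1)) = p) : ∀ᵐ z ∂ρ, z.2.1 = f z.1 := by
  rw [← h] at hf
  exact ae_of_ae_map (by fun_prop) hf

variable [IsProbabilityMeasure p]

lemma IsBottleneck.isProbabilityMeasure (h : IsBottleneck p ρ) : IsProbabilityMeasure ρ := by
  have : IsProbabilityMeasure (ρ.map fun z => (z.1, z.2.1)) := by rwa [h.law_eq]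
  exact isProbabilityMeasure_of_map (g := fun z : 𝒳 × 𝒴 × 𝒯 => (z.1, z.2.1)) (by fun_prop)

/-- When `Y` is a function of `X`, the Markov condition `Y - X - T` always holds. -/
lemma isBottleneck_of_law_eq (hfm : Measurable f) (hf : ∀ᵐ z ∂p, z.2 = f z.1)
    (h : ρ.map (fun z => (z.1, z.2.1)) = p) : IsBottleneck p ρ := by
  refine ⟨h, fun A B hA hB => ?_⟩
  have : IsProbabilityMeasure (ρ.map fun z => (z.1, z.2.1)) := by rwa [h]
  have := isProbabilityMeasure_of_map (ρ := ρ) (g := fun z : 𝒳 × 𝒴 × 𝒯 => (z.1, z.2.1))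
    (by fun_prop)
  have hae := ae_eq_of_law_eq hf h
  have hm : Measurable fun z : 𝒳 × 𝒴 × 𝒯 => z.1 := measurable_fst
  have hmle := hm.comap_le
  -- A version of the indicator of `Y ∈ A` measurable with respect to `X`, so it pulls out of the
  -- conditional expectation.
  let F : 𝒳 × 𝒴 × 𝒯 → ℝ := ((fun z => z.1) ⁻¹' (f ⁻¹' A)).indicator fun _ => 1
  have hF : StronglyMeasurable[MeasurableSpace.comap (fun z => z.1) inferInstance] F :=
    stronglyMeasurable_const.indicator ⟨f ⁻¹' A, hfm hA, rfl⟩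
  let G : 𝒳 × 𝒴 × 𝒯 → ℝ := ((fun z => z.2.2) ⁻¹' B).indicator fun _ => 1
  have hG : Integrable G ρ :=
    (integrable_const _).indicator ((measurable_snd.comp measurable_snd) hB)
  have hFi : Integrable F ρ := (integrable_const _).indicator (measurable_fst (hfm hA))
  have h1 : (((fun z => z.2.1) ⁻¹' A).indicator fun _ => (1 : ℝ)) =ᵐ[ρ] F := by
    filter_upwards [hae] with z hz
    by_cases hz1 : f z.1 ∈ A <;> simp [F, indicator, hz, hz1]
  have h2 : (((fun z => z.2.1) ⁻¹' A ∩ (fun z => z.2.2) ⁻¹' B).indicator fun _ => (1 : ℝ))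
      =ᵐ[ρ] F * G := by
    filter_upwards [hae] with z hz
    by_cases hz1 : f z.1 ∈ A <;> by_cases hz2 : z.2.2 ∈ B <;> simp [F, G, indicator, hz, hz1, hz2]
  have hb : ∀ᵐ z ∂ρ, ‖F z‖ ≤ 1 := .of_forall fun z => by
    by_cases hz1 : f z.1 ∈ A <;> simp [F, hz1]
  have h3 := condExp_stronglyMeasurable_mul_of_bound hmle hF hG 1 hb
  have h4 := condExp_congr_ae (m := MeasurableSpace.comap (fun z => z.1) inferInstance) h1
  rw [condExp_of_stronglyMeasurable hmle hF hFi] at h4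
  filter_upwards [condExp_congr_ae h2, h3, h4] with z hz2 hz3 hz4
  rw [hz2, hz3, hz4]; rfl

/-- The data processing inequality `I(Y;T) ≤ I(X;T)`. -/
lemma infoYT_le_infoXT (hfm : Measurable f) (hf : ∀ᵐ z ∂p, z.2 = f z.1)
    (h : IsBottleneck p ρ) : infoYT ρ ≤ infoXT ρ := by
  have := h.isProbabilityMeasure
  rw [infoYT, infoXT, mutualInfo_congr (ae_eq_of_law_eq hf h.law_eq) .rfl]
  exact mutualInfo_comp_left_le (by fun_prop) (by fun_prop) hfm

variable {𝒵 : Type*} [MeasurableSpace 𝒵] [Zero 𝒵]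

/-- The joint law of `(X, Y, B · g(Y))`. -/
noncomputable def gatedLaw (p : Measure (𝒳 × 𝒴)) (g : 𝒴 → 𝒵) (a : unitInterval) :
    Measure (𝒳 × 𝒴 × 𝒵) :=
  (p.prod (bernoulliMeasure true false a)).map fun z => (z.1.1, z.1.2, gate (g z.1.2, z.2))

lemma bernoulliBottleneck_eq_gatedLaw [Zero 𝒴] (p : Measure (𝒳 × 𝒴)) (a : unitInterval) :
    bernoulliBottleneck p a = gatedLaw p id a := rfl

variable [Countable 𝒴] [MeasurableSingletonClass 𝒴]

lemma infoYT_le_entropy (h : IsBottleneck p ρ) : infoYT ρ ≤ entropy (p.map Prod.snd) id := by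
  have := h.isProbabilityMeasure
  refine (mutualInfo_le_self (by fun_prop) (by fun_prop)).trans_eq ?_
  rw [mutualInfo_self (by fun_prop), entropy_eq_entropy_id, ← h.law_eq,
    Measure.map_map (by fun_prop) (by fun_prop)]
  rfl

lemma measurable_gate_comp (g : 𝒴 → 𝒵) :
    Measurable fun z : (𝒳 × 𝒴) × Bool => gate (g z.1.2, z.2) :=
  (Measurable.of_discrete (f := fun w : 𝒴 × Bool => gate (g w.1, w.2))).comp
    (g := fun w : 𝒴 × Bool => gate (g w.1, w.2)) (by fun_prop : Measurable
      fun z : (𝒳 × 𝒴) × Bool => (z.1.2, z.2))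

lemma isBottleneck_gatedLaw (hfm : Measurable f) (hf : ∀ᵐ z ∂p, z.2 = f z.1) (g : 𝒴 → 𝒵)
    (a : unitInterval) : IsBottleneck p (gatedLaw p g a) := by
  refine isBottleneck_of_law_eq hfm hf ?_
  have := measurable_gate_comp (𝒳 := 𝒳) g
  rw [gatedLaw, Measure.map_map (by fun_prop) (by fun_prop)]
  change (p.prod _).map Prod.fst = p
  rw [Measure.map_fst_prod, measure_univ, one_smul]

variable [Countable 𝒵] [MeasurableSingletonClass 𝒵]

lemma mutualInfo_gate_eq (p : Measure (𝒳 × 𝒴)) [IsProbabilityMeasure p] (g : 𝒴 → 𝒵)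
    (a : unitInterval) :
    mutualInfo (((p.map Prod.snd).map g).prod (bernoulliMeasure true false a)) Prod.fst gate =
      mutualInfo (p.prod (bernoulliMeasure true false a)) (fun z => g z.1.2)
        (fun z => gate (g z.1.2, z.2)) := by
  have hg : Measurable g := .of_discrete
  have h : ((p.map Prod.snd).map g).prod (bernoulliMeasure true false a) =
      (p.prod (bernoulliMeasure true false a)).map (Prod.map (g ∘ Prod.snd) id) := by
    rw [← Measure.map_prod_map _ _ (hg.comp measurable_snd) measurable_id, Measure.map_id,
      Measure.map_map hg measurable_snd]
  rw [h, mutualInfo_map ((hg.comp measurable_snd).prodMap measurable_id) measurable_fst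
    measurable_gate]
  rfl

/-- The bottleneck variable `B · g(Y)` attains equality in the data processing inequality. -/
lemma infoXT_gatedLaw (hfm : Measurable f) (hf : ∀ᵐ z ∂p, z.2 = f z.1) (g : 𝒴 → 𝒵)
    (a : unitInterval) :
    infoXT (gatedLaw p g a) = mutualInfo
        (((p.map Prod.snd).map g).prod (bernoulliMeasure true false a)) Prod.fst gate ∧
      infoYT (gatedLaw p g a) = mutualInfo
        (((p.map Prod.snd).map g).prod (bernoulliMeasure true false a)) Prod.fst gate := by
  have hg : Measurable g := .of_discrete
  have hgate := measurable_gate_comp (𝒳 := 𝒳) g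
  have hdpi := infoYT_le_infoXT hfm hf (isBottleneck_gatedLaw hfm hf g a)
  rw [mutualInfo_gate_eq]
  set R := p.prod (bernoulliMeasure true false a) with hR
  have hX : infoXT (gatedLaw p g a) =
      mutualInfo R (fun z => z.1.1) (fun z => gate (g z.1.2, z.2)) := by
    rw [infoXT, gatedLaw, mutualInfo_map (by fun_prop) (by fun_prop) (by fun_prop)]; rfl
  have hY : infoYT (gatedLaw p g a) =
      mutualInfo R (fun z => z.1.2) (fun z => gate (g z.1.2, z.2)) := by
    rw [infoYT, gatedLaw, mutualInfo_map (by fun_prop) (by fun_prop) (by fun_prop)]; rfl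
  have hge : mutualInfo R (fun z => g z.1.2) (fun z => gate (g z.1.2, z.2)) ≤
      infoYT (gatedLaw p g a) := by
    rw [hY]
    exact mutualInfo_comp_left_le (by fun_prop) hgate hg
  have hle : infoXT (gatedLaw p g a) ≤
      mutualInfo R (fun z => g z.1.2) (fun z => gate (g z.1.2, z.2)) := by
    rw [hX]
    -- Once `g(Y) = v` is fixed, `T = gate (v, B)` depends on `B` only, so all four events are
    -- rectangles for the product measure.
    refine mutualInfo_le_of_condIndep_discrete (by fun_prop) (by fun_prop) hgate
      fun v A C hA hC => ?_
    have e1 : (fun z : (𝒳 × 𝒴) × Bool => g z.1.2) ⁻¹' {v} = (Prod.snd ⁻¹' (g ⁻¹' {v})) ×ˢ univ := by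
      ext z; simp
    have e2 : (fun z : (𝒳 × 𝒴) × Bool => g z.1.2) ⁻¹' {v} ∩ (fun z => z.1.1) ⁻¹' A =
        (Prod.snd ⁻¹' (g ⁻¹' {v}) ∩ Prod.fst ⁻¹' A) ×ˢ univ := by
      ext z; simp
    have e3 : (fun z : (𝒳 × 𝒴) × Bool => g z.1.2) ⁻¹' {v} ∩
        (fun z => gate (g z.1.2, z.2)) ⁻¹' C =
        (Prod.snd ⁻¹' (g ⁻¹' {v})) ×ˢ {b | gate (v, b) ∈ C} := by
      ext z
      simp only [mem_inter_iff, mem_preimage, mem_singleton_iff, mem_prod, mem_ofPred_eq]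
      constructor <;> rintro ⟨rfl, h⟩ <;> exact ⟨rfl, h⟩
    have e4 : (fun z : (𝒳 × 𝒴) × Bool => g z.1.2) ⁻¹' {v} ∩ ((fun z => z.1.1) ⁻¹' A ∩
        (fun z => gate (g z.1.2, z.2)) ⁻¹' C) =
        (Prod.snd ⁻¹' (g ⁻¹' {v}) ∩ Prod.fst ⁻¹' A) ×ˢ {b | gate (v, b) ∈ C} := by
      ext z
      simp only [mem_inter_iff, mem_preimage, mem_singleton_iff, mem_prod, mem_ofPred_eq]
      constructor
      · rintro ⟨rfl, h, h'⟩; exact ⟨⟨rfl, h⟩, h'⟩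
      · rintro ⟨⟨rfl, h⟩, h'⟩; exact ⟨rfl, h, h'⟩
    rw [e4, e2, e3, e1, hR, Measure.prod_prod, Measure.prod_prod, Measure.prod_prod,
      Measure.prod_prod, measure_univ]
    ring
  exact ⟨le_antisymm hle (hge.trans hdpi), le_antisymm (hdpi.trans hle) hge⟩

end BottleneckVariables

/-! ### Reaching every value up to `H(Y)`, finite or not -/

section Attainment

variable {𝒴 : Type*} [MeasurableSpace 𝒴] [Countable 𝒴] [MeasurableSingletonClass 𝒴]

/-- Outcome spaces range over an arbitrary universe, so the natural labels of the optimal variables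
are lifted there. -/
instance measurableSingletonClass_ulift_nat : MeasurableSingletonClass (ULift.{w} ℕ) :=
  ⟨fun x => (.of_discrete : MeasurableSet (ULift.up ⁻¹' {x} : Set ℕ))⟩

/-- With entropy written as `I(V;V)`, data processing applies both to `g` and to its left inverse.
-/
lemma entropy_map_of_injective {𝒵 : Type*} [MeasurableSpace 𝒵] [Countable 𝒵]
    [MeasurableSingletonClass 𝒵] (q : Measure 𝒴) [IsProbabilityMeasure q] {g : 𝒴 → 𝒵}
    (hg : Function.Injective g) : entropy (q.map g) id = entropy q id := by
  have hgm : Measurable g := .of_discrete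
  have : Nonempty 𝒴 := nonempty_of_isProbabilityMeasure q
  rw [← entropy_eq_entropy_id, ← mutualInfo_self hgm, ← mutualInfo_self measurable_id]
  apply le_antisymm
  · refine (mutualInfo_comp_left_le (U := id) measurable_id hgm hgm).trans ?_
    exact mutualInfo_le_self measurable_id hgm
  · have h : (id : 𝒴 → 𝒴) = Function.invFun g ∘ g := (Function.invFun_comp hg).symm
    calc mutualInfo q id id = mutualInfo q (Function.invFun g ∘ g) id := by rw [← h]
      _ ≤ mutualInfo q g id := mutualInfo_comp_left_le hgm measurable_id .of_discrete
      _ ≤ mutualInfo q g g := mutualInfo_le_self hgm measurable_id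

/-- Lumping all but finitely many labels gives finite entropies arbitrarily close to `H(Y)`. -/
lemma exists_finite_entropy_gt (q : Measure 𝒴) [IsProbabilityMeasure q] {s : ℝ≥0∞}
    (hs : s < entropy q id) :
    ∃ g : 𝒴 → ULift.{w} ℕ, s < entropy (q.map g) id ∧ entropy (q.map g) id ≠ ∞ := by
  classical
  obtain ⟨e, he⟩ := exists_injective_nat 𝒴
  rw [entropy, Measure.map_id, ENNReal.tsum_eq_iSup_sum, lt_iSup_iff] at hs
  obtain ⟨t, ht⟩ := hs
  -- The shift keeps label `0` free for the lumped class, so labels in `t` keep their probabilities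
  -- and the partial sum above `s` survives.
  let ι : 𝒴 ↪ ULift.{w} ℕ := ⟨fun y => ⟨e y + 1⟩, fun y y' h => he (by simpa using h)⟩
  have hι0 (y : 𝒴) : ι y ≠ ⟨0⟩ := fun h => by simpa [ι] using congrArg ULift.down h
  let g : 𝒴 → ULift.{w} ℕ := fun y => if y ∈ t then ι y else ⟨0⟩
  have hg : Measurable g := .of_discrete
  refine ⟨g, ?_, ?_⟩
  · rw [entropy, Measure.map_id]
    refine lt_of_lt_of_le ht (le_trans (le_of_eq ?_) (ENNReal.sum_le_tsum (t.map ι)))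
    rw [Finset.sum_map]
    refine Finset.sum_congr rfl fun y hy => ?_
    rw [map_measureReal_apply hg (measurableSet_singleton _)]
    congr 3
    ext y'
    simp only [mem_singleton_iff, mem_preimage, g]
    constructor
    · rintro rfl; rw [if_pos hy]
    · split_ifs with h
      · exact fun h' => ι.injective h'
      · exact fun h' => absurd h'.symm (hι0 y)
  · rw [entropy, Measure.map_id, tsum_eq_sum (s := insert ⟨0⟩ (t.map ι))]
    · exact ENNReal.sum_ne_top.2 fun _ _ => ENNReal.ofReal_ne_top
    · intro n hn
      have : g ⁻¹' {n} = ∅ := by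
        ext y
        simp only [mem_preimage, mem_singleton_iff, mem_empty_iff_false, iff_false]
        rintro rfl
        apply hn
        by_cases h : y ∈ t <;> simp [g, h]
      rw [map_measureReal_apply hg (measurableSet_singleton _), this]
      simp

/-- Every value in `[0, H(Y)]` is the information of some `B · g(Y)` with natural labels. -/
lemma exists_label_mutualInfo_gate_eq (q : Measure 𝒴) [IsProbabilityMeasure q] {s : ℝ≥0∞}
    (hs : s ≤ entropy q id) :
    ∃ (g : 𝒴 → ULift.{w} ℕ) (a : unitInterval),
      mutualInfo ((q.map g).prod (bernoulliMeasure true false a)) Prod.fst gate = s := by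
  -- Below `H(Y)` a finite-entropy lumping and continuity suffice; the value `H(Y)`, possibly `∞`,
  -- needs all labels and `a = 1`.
  rcases hs.lt_or_eq with hlt | rfl
  · obtain ⟨g, hg, hfin⟩ := exists_finite_entropy_gt.{w} q hlt
    have := Measure.isProbabilityMeasure_map (μ := q) (f := g) Measurable.of_discrete.aemeasurable
    exact ⟨g, exists_mutualInfo_gate_eq _ hfin hg.le⟩
  · obtain ⟨e, he⟩ := exists_injective_nat 𝒴
    have := Measure.isProbabilityMeasure_map (μ := q) (f := fun y => ULift.up.{w} (e y))
      Measurable.of_discrete.aemeasurable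
    refine ⟨fun y => ⟨e y⟩, 1, ?_⟩
    rw [mutualInfo_gate_one, entropy_map_of_injective]
    exact fun y y' h => he (by simpa using h)

end Attainment

/-! ### The shape of the curve -/

section Curve

variable {𝒳 : Type u} {𝒴 : Type v} [MeasurableSpace 𝒳] [MeasurableSpace 𝒴]
  [Countable 𝒴] [MeasurableSingletonClass 𝒴]

lemma isGreatest_feasibleValues {p : Measure (𝒳 × 𝒴)} [IsProbabilityMeasure p] {f : 𝒳 → 𝒴}
    (hfm : Measurable f) (hf : ∀ᵐ z ∂p, z.2 = f z.1) (r : ℝ≥0∞) :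
    IsGreatest (feasibleValues.{u, v, w} p r) (min r (entropy (p.map Prod.snd) id)) := by
  have := Measure.isProbabilityMeasure_map (μ := p) measurable_snd.aemeasurable
  constructor
  · obtain ⟨g, a, ha⟩ := exists_label_mutualInfo_gate_eq.{w} (p.map Prod.snd)
      (min_le_right r _)
    obtain ⟨hX, hY⟩ := infoXT_gatedLaw hfm hf g a
    rw [ha] at hX hY
    exact ⟨_, _, gatedLaw p g a, isBottleneck_gatedLaw hfm hf g a,
      hX.trans_le (min_le_left _ _), hY.symm⟩
  · rintro _ ⟨𝒯, _, ρ, hρ, hr, rfl⟩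
    exact le_min ((infoYT_le_infoXT hfm hf hρ).trans hr) (infoYT_le_entropy hρ)

/-- The only possible break point is `H.toReal`, and there is none when `H = ∞`. -/
lemma isPiecewiseLinearOn_min (H : ℝ≥0∞) {F : ℝ → ℝ}
    (hF : ∀ r, F r = (min (ENNReal.ofReal r) H).toReal) : IsPiecewiseLinearOn F (Ici 0) := by
  rcases eq_or_ne H ∞ with rfl | hH
  · have h (r : ℝ) (hr : r ∈ Ici (0 : ℝ)) : F r = r := by
      rw [hF, min_eq_left le_top, ENNReal.toReal_ofReal hr]
    refine ⟨continuousOn_id.congr h, ∅, fun a b hab _ => ⟨1, 0, fun x hx => ?_⟩⟩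
    rw [h x (hab hx)]; ring
  · have h (r : ℝ) (hr : r ∈ Ici (0 : ℝ)) : F r = min r H.toReal := by
      rw [hF, ENNReal.toReal_min ENNReal.ofReal_ne_top hH, ENNReal.toReal_ofReal hr]
    refine ⟨(continuous_id.min continuous_const).continuousOn.congr h, {H.toReal},
      fun a b hab hD => ?_⟩
    have hD' : H.toReal ∉ Ioo a b := by simpa using hD
    by_cases ha : a < H.toReal
    · have hb : b ≤ H.toReal := not_lt.1 fun hb => hD' ⟨ha, hb⟩
      refine ⟨1, 0, fun x hx => ?_⟩
      rw [h x (hab hx), min_eq_left (hx.2.trans hb)]; ring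
    · refine ⟨0, H.toReal, fun x hx => ?_⟩
      rw [h x (hab hx), min_eq_right ((not_lt.1 ha).trans hx.1)]; ring

/-- Strict concavity fails at the midpoint of an affine stretch: `[0, 1]` if `H = ∞`, otherwise the
flat piece from `H.toReal` to `H.toReal + 1`. -/
lemma not_strictConcaveOn_min (H : ℝ≥0∞) {F : ℝ → ℝ}
    (hF : ∀ r, F r = (min (ENNReal.ofReal r) H).toReal) : ¬ StrictConcaveOn ℝ (Ici 0) F := by
  intro hc
  rcases eq_or_ne H ∞ with rfl | hH
  · have h (r : ℝ) (hr : 0 ≤ r) : F r = r := by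
      rw [hF, min_eq_left le_top, ENNReal.toReal_ofReal hr]
    have := hc.2 (show (0 : ℝ) ∈ Ici 0 by simp) (show (1 : ℝ) ∈ Ici 0 by simp)
      (by simp) (show (0 : ℝ) < 1 / 2 by norm_num) (show (0 : ℝ) < 1 / 2 by norm_num) (by norm_num)
    rw [h 0 (by norm_num), h 1 (by norm_num), h _ (by norm_num)] at this
    norm_num at this
  · have h (r : ℝ) (hr : H.toReal ≤ r) : F r = H.toReal := by
      rw [hF, min_eq_right]
      rwa [← ENNReal.ofReal_toReal hH, ENNReal.ofReal_le_ofReal_iff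
        (ENNReal.toReal_nonneg.trans hr)]
    have h0 : 0 ≤ H.toReal := ENNReal.toReal_nonneg
    have := hc.2 h0 (show H.toReal + 1 ∈ Ici 0 by simp only [mem_Ici]; linarith)
      (by simp) (show (0 : ℝ) < 1 / 2 by norm_num) (show (0 : ℝ) < 1 / 2 by norm_num)
      (by norm_num)
    rw [h _ le_rfl, h (H.toReal + 1) (by linarith), h _ (by
      simp only [smul_eq_mul]; linarith)] at this
    simp only [smul_eq_mul] at this
    linarith

end Curve

end InfoBottleneck

/-! ### The main theorem -/

theorem mainTheorem1 {Ω : Type t} {𝒳 : Type u} {𝒴 : Type v}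
    [MeasurableSpace Ω] [MeasurableSpace 𝒳]
    [MeasurableSpace 𝒴] [Countable 𝒴] [MeasurableSingletonClass 𝒴] [Zero 𝒴]
    (P : Measure Ω) [IsProbabilityMeasure P]
    (X : Ω → 𝒳) (Y : Ω → 𝒴) (hX : Measurable X) (hY : Measurable Y)
    (f : 𝒳 → 𝒴) (hf : Measurable f) (hYX : ∀ᵐ ω ∂P, Y ω = f (X ω))
    (p : Measure (𝒳 × 𝒴)) (hp : p = P.map fun ω => (X ω, Y ω))
    (H : ℝ≥0∞) (hH : H = InfoBottleneck.entropy P Y) :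
    -- the IB curve is `min {r, H(Y)}`, and the maximum defining it is attained
    (∀ r : ℝ≥0∞, InfoBottleneck.ibCurve.{u, v, w} p r = min r H ∧
      IsGreatest (InfoBottleneck.feasibleValues.{u, v, w} p r) (min r H)) ∧
    -- it saturates the DPI bound up to `H(Y)` and is flat at `H(Y)` beyond
    (∀ r ≤ H, InfoBottleneck.ibCurve.{u, v, w} p r = r) ∧
    (∀ r, H ≤ r → InfoBottleneck.ibCurve.{u, v, w} p r = H) ∧
    -- it is piecewise linear and not strictly concave
    InfoBottleneck.IsPiecewiseLinearOn (InfoBottleneck.ibCurveReal.{u, v, w} p) (Ici 0) ∧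
    ¬ StrictConcaveOn ℝ (Ici 0) (InfoBottleneck.ibCurveReal.{u, v, w} p) ∧
    -- each `T_α` is a bottleneck variable that attains the DPI bound
    (∀ a : unitInterval,
      InfoBottleneck.IsBottleneck p (InfoBottleneck.bernoulliBottleneck p a) ∧
      InfoBottleneck.infoYT (InfoBottleneck.bernoulliBottleneck p a) =
        InfoBottleneck.infoXT (InfoBottleneck.bernoulliBottleneck p a)) ∧
    InfoBottleneck.infoXT (InfoBottleneck.bernoulliBottleneck p 0) = 0 ∧
    InfoBottleneck.infoXT (InfoBottleneck.bernoulliBottleneck p 1) = H ∧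
    -- if `H(Y)` is finite, the family `T_α` sweeps exactly the range `[0, H(Y)]`
    (H ≠ ∞ →
      range (fun a : unitInterval =>
        (InfoBottleneck.infoXT (InfoBottleneck.bernoulliBottleneck p a),
          InfoBottleneck.infoYT (InfoBottleneck.bernoulliBottleneck p a))) =
        {q | q.1 = q.2 ∧ q.1 ≤ H}) := by
  have hp_prob : IsProbabilityMeasure p := by
    rw [hp]; exact Measure.isProbabilityMeasure_map (hX.prodMk hY).aemeasurable
  have hpf : ∀ᵐ z ∂p, z.2 = f z.1 := by
    rw [hp]
    exact (ae_map_iff (hX.prodMk hY).aemeasurable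
      (measurableSet_eq_fun measurable_snd (hf.comp measurable_fst))).2 hYX
  have hq : p.map Prod.snd = P.map Y := by
    rw [hp, Measure.map_map measurable_snd (hX.prodMk hY)]; rfl
  have hHq : H = InfoBottleneck.entropy (p.map Prod.snd) id := by
    rw [hH, hq, InfoBottleneck.entropy_eq_entropy_id]
  have hq_prob : IsProbabilityMeasure (p.map Prod.snd) :=
    Measure.isProbabilityMeasure_map measurable_snd.aemeasurable
  have hgreat (r : ℝ≥0∞) := InfoBottleneck.isGreatest_feasibleValues.{u, v, w} hf hpf r
  simp only [← hHq] at hgreat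
  have hcurve (r : ℝ≥0∞) : InfoBottleneck.ibCurve.{u, v, w} p r = min r H :=
    (hgreat r).isLUB.sSup_eq
  have hreal (r : ℝ) : InfoBottleneck.ibCurveReal.{u, v, w} p r =
      (min (ENNReal.ofReal r) H).toReal := by
    rw [InfoBottleneck.ibCurveReal, hcurve]
  -- The family `T_α` is the case `g = id`, where no lumping takes place.
  have hinfo (a : unitInterval) :=
    InfoBottleneck.infoXT_gatedLaw hf hpf (id : 𝒴 → 𝒴) a
  simp only [Measure.map_id, ← InfoBottleneck.bernoulliBottleneck_eq_gatedLaw] at hinfo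
  refine ⟨fun r => ⟨hcurve r, hgreat r⟩, fun r hr => by rw [hcurve, min_eq_left hr],
    fun r hr => by rw [hcurve, min_eq_right hr], InfoBottleneck.isPiecewiseLinearOn_min H hreal,
    InfoBottleneck.not_strictConcaveOn_min H hreal,
    fun a => ⟨InfoBottleneck.isBottleneck_gatedLaw hf hpf id a,
      (hinfo a).2.trans (hinfo a).1.symm⟩, ?_, ?_, fun hfin => ?_⟩
  · rw [(hinfo 0).1, InfoBottleneck.mutualInfo_gate_zero]
  · rw [(hinfo 1).1, InfoBottleneck.mutualInfo_gate_one, hHq]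
  · ext ⟨s, s'⟩
    simp only [mem_range, Prod.mk.injEq, mem_ofPred_eq, (hinfo _).1, (hinfo _).2]
    constructor
    · rintro ⟨a, rfl, rfl⟩
      exact ⟨rfl, hHq ▸ InfoBottleneck.mutualInfo_gate_le _ a⟩
    · rintro ⟨rfl, hs⟩
      rw [hHq] at hfin hs
      obtain ⟨a, ha⟩ := InfoBottleneck.exists_mutualInfo_gate_eq _ hfin hs
      exact ⟨a, ha, ha⟩
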